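/- Let $\mathbb S^2\subset\mathbb R^3$ be the unit sphere, with geodesic distance $\arccos(P\cdot Q)$, and for $P\in\mathbb S^2$ let $H(P)=\{Q\in\mathbb S^2 : P\cdot Q\ge 0\}$ be the closed hemisphere centered at $P$. A spherical convex body is a closed set $C\subset\mathbb S^2$ with nonempty interior that is disjoint from some closed hemisphere and contains, with any two of its points, the shorter great circle arc joining them. The hemisphere $H(Q)$ supports $C$ if $C\subset H(Q)$ and $Q\cdot R=0$ for some $R\in C$. The width of $C$ with respect to a supporting hemisphere $H(P)$ is the minimum of the thicknesses $\pi-\arccos(P\cdot Q)$ of the lunes $H(P)\cap H(Q)$, over all $Q\ne P$ such that $H(Q)$ supports $C$; and $C$ is of constant width $\tau$ if its width with respect to every supporting hemisphere is $\tau$. A spherical polytope is a spherical convex body that is the intersection of finitely many closed hemispheres. **Theorem 1.3.** For every spherical convex body $C\subset\mathbb S^2$ of constant width $\pi/2$ and every $\varepsilon>0$ there exists a spherical polytope $\mathcal P_\varepsilon\subset\mathbb S^2$ of constant width $\pi/2$ such that $h(C,\mathcal P_\varepsilon)\le\varepsilon$, where $h$ is the Hausdorff distance with respect to the geodesic distance.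 -/

import Mathlib

noncomputable section

namespace SphericalConvex

/-- The unit sphere `𝕊ⁿ` of `ℝⁿ⁺¹`, with its subspace topology. -/
abbrev Sph (n : ℕ) : Type := Metric.sphere (0 : EuclideanSpace ℝ (Fin (n + 1))) 1

/-- The dot product in `ℝⁿ⁺¹` of two points of the sphere. -/
def dot {n : ℕ} (P Q : Sph n) : ℝ :=
  inner ℝ (P : EuclideanSpace ℝ (Fin (n + 1))) (Q : EuclideanSpace ℝ (Fin (n + 1)))

/-- The geodesic (great circle) distance `arccos (P · Q)` on the sphere. -/
def geodist {n : ℕ} (P Q : Sph n) : ℝ := Real.arccos (dot P Q)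

/-- The closed hemisphere `H(P)` centered at `P`. -/
def hemisphere {n : ℕ} (P : Sph n) : Set (Sph n) := {Q | 0 ≤ dot P Q}

/-- The great circle arc with end points `P` and `Q`, `P ≠ -Q`, not containing `-P`, `-Q`
(the points of the sphere in the convex cone spanned by `P` and `Q`). -/
def arc {n : ℕ} (P Q : Sph n) : Set (Sph n) :=
  {R | ∃ a b : ℝ, 0 ≤ a ∧ 0 ≤ b ∧
    (R : EuclideanSpace ℝ (Fin (n + 1))) = a • (P : EuclideanSpace ℝ (Fin (n + 1))) +
      b • (Q : EuclideanSpace ℝ (Fin (n + 1)))}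

/-- A nonempty subset of the sphere that misses some closed hemisphere. -/
def IsHemispherical {n : ℕ} (W : Set (Sph n)) : Prop :=
  W.Nonempty ∧ ∃ P : Sph n, W ∩ hemisphere P = ∅

/-- A hemispherical set containing the arc `PQ` for any two of its points `P`, `Q`. -/
def IsSphericalConvex {n : ℕ} (C : Set (Sph n)) : Prop :=
  IsHemispherical C ∧ ∀ P ∈ C, ∀ Q ∈ C, P ≠ -Q → arc P Q ⊆ C

/-- A closed spherical convex set with an interior point (relative to the sphere). -/
def IsSphericalConvexBody {n : ℕ} (C : Set (Sph n)) : Prop :=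
  IsSphericalConvex C ∧ IsClosed C ∧ (interior C).Nonempty

/-- The hemisphere `H(Q)` supports `C` at the point `P` of the boundary of `C`:
`C ⊆ H(Q)` and `P ∈ C ∩ ∂H(Q)`, where `∂H(Q)` is the great sphere orthogonal to `Q`. -/
def SupportsAt {n : ℕ} (Q : Sph n) (C : Set (Sph n)) (P : Sph n) : Prop :=
  P ∈ frontier C ∧ C ⊆ hemisphere Q ∧ P ∈ C ∧ dot Q P = 0

/-- The hemisphere `H(Q)` supports `C` (at some boundary point of `C`). -/
def Supports {n : ℕ} (Q : Sph n) (C : Set (Sph n)) : Prop :=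
  ∃ P : Sph n, SupportsAt Q C P

/-- The thickness `π - arccos (P · Q)` of the lune `H(P) ∩ H(Q)`, `P ≠ Q`. -/
def luneThickness {n : ℕ} (P Q : Sph n) : ℝ := Real.pi - Real.arccos (dot P Q)

/-- The width of `C` with respect to its supporting hemisphere `H(P)` is `w`: `w` is the minimum
of the thicknesses of the lunes `H(P) ∩ H(Q)` over the supporting hemispheres `H(Q)` of `C`
(with `Q ≠ P`, as in every lune). The minimum is required to exist. -/
def HasWidth {n : ℕ} (C : Set (Sph n)) (P : Sph n) (w : ℝ) : Prop :=
  IsLeast {t : ℝ | ∃ Q : Sph n, Supports Q C ∧ P ≠ Q ∧ t = luneThickness P Q} w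

/-- A spherical convex body all of whose widths are equal to `τ`. -/
def IsBodyOfConstantWidth {n : ℕ} (C : Set (Sph n)) (τ : ℝ) : Prop :=
  IsSphericalConvexBody C ∧ ∀ P : Sph n, Supports P C → HasWidth C P τ

/-- A spherical convex body that is the intersection of finitely many hemispheres. -/
def IsSphericalPolytope {n : ℕ} (C : Set (Sph n)) : Prop :=
  IsSphericalConvexBody C ∧
    ∃ F : Set (Sph n), F.Finite ∧ C = ⋂ P ∈ F, hemisphere P

/-- The Hausdorff distance of two (nonempty) subsets of the sphere for the geodesic distance:
the infimum of all `r ≥ 0` such that each set is contained in the closed `r`-neighbourhood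
of the other. The set of these `r` contains `π` if both sets are nonempty. -/
def hausdorffDistance {n : ℕ} (C D : Set (Sph n)) : ℝ :=
  sInf {r : ℝ | 0 ≤ r ∧ (∀ P ∈ C, ∃ Q ∈ D, geodist P Q ≤ r) ∧
    (∀ Q ∈ D, ∃ P ∈ C, geodist P Q ≤ r)}

end SphericalConvex

end

/-! A convex body has constant width `π / 2` exactly when it equals its polar, the set of centers of
hemispheres containing it (`IsBodyOfConstantWidth.polar_eq`, `isBodyOfConstantWidth_of_polar_eq`).
So it suffices to approximate a self-polar `C` by self-polar polytopes.

Take a fine finite net `G` in `C` containing two orthogonal points `p`, `q`. Points of `polar G`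
have nonnegative `p`- and `q`-coordinates, so two of them on the same side of the plane of `p`, `q`
have nonnegative product. Adding to `G` the generators of `polar G` on one side only therefore gives
a finite `F` with `polar F` self-polar (`exists_self_polar_polytope`).

Finally `G ⊆ polar F ⊆ polar G`. The net `G` is close to all of `C`, and points of `polar G` are
close to `polar C = C` (`exists_near_mem_polar`). -/

open Set Filter Topology

namespace SphericalConvex

/-! ### Duals of finitely generated cones, by Fourier-Motzkin elimination. -/

section FourierMotzkin

variable {E : Type*} [NormedAddCommGroup E] [InnerProductSpace ℝ E]

/-- A finite family of lower bounds for `t`, each below each member of a finite family of upper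
bounds, can be met by some `t ≥ 0` provided the upper bounds are nonnegative. -/
lemma exists_nonneg_between {ι : Type*} (A B : Finset ι) (f g : ι → ℝ)
    (hA : ∀ i ∈ A, 0 ≤ f i) (h : ∀ i ∈ A, ∀ j ∈ B, g j ≤ f i) :
    ∃ t : ℝ, 0 ≤ t ∧ (∀ i ∈ A, t ≤ f i) ∧ ∀ j ∈ B, g j ≤ t := by
  classical
  have hne : (insert 0 (B.image g)).Nonempty := Finset.insert_nonempty _ _
  refine ⟨(insert 0 (B.image g)).max' hne, Finset.le_max' _ _ (by simp), fun i hi => ?_,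
    fun j hj => Finset.le_max' _ _ ?_⟩
  · refine Finset.max'_le _ _ _ fun y hy => ?_
    rcases Finset.mem_insert.1 hy with rfl | hy
    · exact hA i hi
    · obtain ⟨j, hj, rfl⟩ := Finset.mem_image.1 hy
      exact h i hi j hj
  · exact Finset.mem_insert_of_mem (Finset.mem_image_of_mem _ hj)

/-- The **Minkowski-Weyl theorem** in dual form: the dual of a finite set `G` has the same dual as
some finite subset `H` of it. -/
lemma exists_finset_dual_generators [FiniteDimensional ℝ E] (G : Finset E) :
    ∃ H : Finset E, (∀ h ∈ H, ∀ g ∈ G, 0 ≤ inner ℝ h g) ∧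
      ∀ x : E, (∀ h ∈ H, 0 ≤ inner ℝ h x) →
        ∀ y : E, (∀ g ∈ G, 0 ≤ inner ℝ y g) → 0 ≤ inner ℝ y x := by
  classical
  induction G using Finset.induction_on with
  | empty =>
    let b := stdOrthonormalBasis ℝ E
    refine ⟨Finset.univ.image b ∪ Finset.univ.image fun i => -b i, by simp, fun x hx y _ => ?_⟩
    rw [← b.sum_inner_mul_inner y x]
    refine Finset.sum_nonneg fun i _ => ?_
    have h1 := hx (b i) (by simp)
    have h2 := hx (-b i) (by simp)
    rw [inner_neg_left] at h2
    rw [show inner ℝ (b i) x = 0 by linarith, mul_zero]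
  | insert g G _ ih =>
    obtain ⟨H, hHG, hH⟩ := ih
    let A := H.filter fun h => 0 < inner ℝ h g
    let B := H.filter fun h => inner ℝ h g < 0
    -- A nonnegative combination of the pair that is orthogonal to `g`.
    let comb : E × E → E := fun p => inner ℝ p.1 g • p.2 - inner ℝ p.2 g • p.1
    refine ⟨H.filter (fun h => 0 ≤ inner ℝ h g) ∪ (A ×ˢ B).image comb, ?_, ?_⟩
    · intro h hh g' hg'
      rcases Finset.mem_union.1 hh with hh | hh
      · rw [Finset.mem_filter] at hh
        rcases Finset.mem_insert.1 hg' with rfl | hg'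
        · exact hh.2
        · exact hHG h hh.1 g' hg'
      · obtain ⟨⟨a, b⟩, hab, rfl⟩ := Finset.mem_image.1 hh
        obtain ⟨ha, hb⟩ := Finset.mem_product.1 hab
        rw [Finset.mem_filter] at ha hb
        simp only [comb, inner_sub_left, real_inner_smul_left] at *
        rcases Finset.mem_insert.1 hg' with rfl | hg'
        · linarith
        · have h1 := mul_nonneg ha.2.le (hHG b hb.1 g' hg')
          have h2 := mul_nonneg (neg_nonneg.2 hb.2.le) (hHG a ha.1 g' hg')
          linarith
    · intro x hx y hy
      obtain ⟨t, ht0, htA, htB⟩ := exists_nonneg_between A B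
        (fun h => inner ℝ h x / inner ℝ h g) (fun h => inner ℝ h x / inner ℝ h g)
        (fun a ha => by
          have ha' := Finset.mem_filter.1 ha
          exact div_nonneg (hx a (Finset.mem_union_left _
            (Finset.mem_filter.2 ⟨ha'.1, ha'.2.le⟩))) ha'.2.le)
        (fun a ha b hb => by
          have hc := hx (comb (a, b)) (Finset.mem_union_right _
            (Finset.mem_image_of_mem _ (Finset.mem_product.2 ⟨ha, hb⟩)))
          have ha' := (Finset.mem_filter.1 ha).2
          have hb' := (Finset.mem_filter.1 hb).2
          simp only [comb, inner_sub_left, real_inner_smul_left] at hc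
          rw [← neg_div_neg_eq, div_le_div_iff₀ (neg_pos.2 hb') ha']
          linarith)
      -- The bounds on `t` say exactly that `x - t • g` satisfies every constraint in `H`; the
      -- `comb` constraints made them compatible.
      have key : 0 ≤ inner ℝ y (x - t • g) := by
        refine hH _ (fun h hh => ?_) y fun g' hg' => hy g' (Finset.mem_insert_of_mem hg')
        rw [inner_sub_right, real_inner_smul_right]
        rcases lt_trichotomy (inner ℝ h g) 0 with hs | hs | hs
        · have := htB h (Finset.mem_filter.2 ⟨hh, hs⟩)
          rw [div_le_iff_of_neg hs] at this
          linarith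
        · have := hx h (Finset.mem_union_left _ (Finset.mem_filter.2 ⟨hh, hs.ge⟩))
          rw [hs]; linarith
        · have := htA h (Finset.mem_filter.2 ⟨hh, hs⟩)
          rw [le_div_iff₀ hs] at this
          linarith
      rw [inner_sub_right, real_inner_smul_right] at key
      have := mul_nonneg ht0 (hy g (Finset.mem_insert_self _ _))
      linarith

end FourierMotzkin

/-! ### Spherical polars and the bipolar theorem. -/

section Polar

variable {n : ℕ}

/-- The set of centers of the hemispheres containing `C`. -/
def polar (C : Set (Sph n)) : Set (Sph n) := {Q | ∀ R ∈ C, 0 ≤ dot Q R}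

lemma dot_comm (P Q : Sph n) : dot P Q = dot Q P := real_inner_comm _ _

lemma dot_self (P : Sph n) : dot P P = 1 := by
  have : ‖(P : EuclideanSpace ℝ (Fin (n + 1)))‖ = 1 := by simp
  simp [dot, this]

lemma dot_neg_left (P Q : Sph n) : dot (-P) Q = -dot P Q := by simp [dot]

lemma dot_le_one (P Q : Sph n) : dot P Q ≤ 1 := by
  simpa [dot] using real_inner_le_norm (P : EuclideanSpace ℝ (Fin (n + 1))) Q

lemma continuous_dot (P : Sph n) : Continuous (dot P) := by
  unfold dot; fun_prop

lemma exists_eq_smul {v : EuclideanSpace ℝ (Fin (n + 1))} (hv : v ≠ 0) :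
    ∃ P : Sph n, v = ‖v‖ • (P : EuclideanSpace ℝ (Fin (n + 1))) := by
  have h : ‖v‖ ≠ 0 := norm_ne_zero_iff.2 hv
  exact ⟨⟨‖v‖⁻¹ • v, by simp [norm_smul, h]⟩, by simp [smul_smul, h]⟩

lemma isClosed_polar (C : Set (Sph n)) : IsClosed (polar C) := by
  have : polar C = ⋂ R ∈ C, {Q | 0 ≤ dot R Q} := by
    ext Q; simp [polar, dot_comm]
  rw [this]
  exact isClosed_biInter fun R _ => isClosed_le continuous_const (continuous_dot R)

/-- A continuous function positive on a nonempty closed set of the sphere is bounded below there by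
a positive constant. -/
lemma exists_pos_le_of_pos {C : Set (Sph n)} (hC : IsClosed C) {f : Sph n → ℝ}
    (hf : Continuous f) (h : ∀ R ∈ C, 0 < f R) : ∃ r > 0, ∀ R ∈ C, r ≤ f R := by
  rcases C.eq_empty_or_nonempty with rfl | hne
  · exact ⟨1, one_pos, by simp⟩
  · obtain ⟨x, hx, hmin⟩ := hC.isCompact.exists_isMinOn hne hf.continuousOn
    exact ⟨f x, h x hx, fun R hR => hmin hR⟩

/-- Centers of hemispheres containing `C` have positive product with interior points of `C`. -/
lemma dot_pos_of_mem_interior {C : Set (Sph n)} {Q R : Sph n} (hQ : Q ∈ polar C)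
    (hR : R ∈ interior C) : 0 < dot Q R := by
  by_contra! hle
  set q := (Q : EuclideanSpace ℝ (Fin (n + 1))) with hq
  set r := (R : EuclideanSpace ℝ (Fin (n + 1))) with hr
  have hqq : inner ℝ q q = (1 : ℝ) := dot_self Q
  have hqr : inner ℝ q r ≤ (0 : ℝ) := hle
  have hr1 : ‖r‖ = 1 := by simp [r]
  have hne : ∀ s : ℝ, 0 ≤ s → r - s • q ≠ 0 := fun s hs h0 => by
    have h1 : inner ℝ r (r - s • q) = (0 : ℝ) := by rw [h0, inner_zero_right]
    rw [inner_sub_right, real_inner_smul_right, real_inner_self_eq_norm_sq, hr1,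
      real_inner_comm] at h1
    nlinarith
  -- Moving from `R` away from `Q` makes the product with `Q` negative while staying in `C`. The
  -- default value `R` is never taken for `s ≥ 0`, by `hne`.
  let γ : ℝ → Sph n := fun s =>
    if h : r - s • q = 0 then R else ⟨‖r - s • q‖⁻¹ • (r - s • q), by simp [norm_smul, h]⟩
  have hγ : Tendsto γ (𝓝[>] 0) (𝓝 R) := by
    rw [tendsto_subtype_rng]
    have h1 : Tendsto (fun s : ℝ => ‖r - s • q‖⁻¹ • (r - s • q)) (𝓝[>] 0) (𝓝 r) := by
      have : ContinuousAt (fun s : ℝ => ‖r - s • q‖⁻¹ • (r - s • q)) 0 := by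
        have h0 : ContinuousAt (fun s : ℝ => r - s • q) 0 := by fun_prop
        exact (h0.norm.inv₀ (by simp [hr1])).smul h0
      have h2 := this.tendsto
      simp only [zero_smul, sub_zero, hr1, inv_one, one_smul] at h2
      exact h2.mono_left nhdsWithin_le_nhds
    refine h1.congr' ?_
    filter_upwards [self_mem_nhdsWithin] with s hs
    simp [γ, hne s (le_of_lt hs)]
  have hev := hγ.eventually (isOpen_interior.mem_nhds hR)
  obtain ⟨s, hsC, hs⟩ := (hev.and self_mem_nhdsWithin).exists
  have hs0 : 0 < s := hs
  have h1 := hQ _ (interior_subset hsC)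
  have h2 := hne s hs0.le
  simp only [γ, h2, dot, dif_neg, not_false_eq_true, ← hq, real_inner_smul_right,
    inner_sub_right, hqq] at h1
  have h3 : 0 < ‖r - s • q‖⁻¹ := inv_pos.2 (norm_pos_iff.2 h2)
  have := nonneg_of_mul_nonneg_right h1 h3
  linarith

/-- `H(Q)` supports a closed set as soon as it contains it and has a point of it on its boundary. -/
lemma supports_of_mem_polar {C : Set (Sph n)} {Q R : Sph n}
    (hQ : Q ∈ polar C) (hR : R ∈ C) (h : dot Q R = 0) : Supports Q C :=
  ⟨R, ⟨subset_closure hR, fun hi => (dot_pos_of_mem_interior hQ hi).ne' h⟩, hQ, hR, h⟩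

/-- The bipolar theorem for spherical convex sets. -/
lemma polar_polar_subset {C : Set (Sph n)} (hC : IsSphericalConvex C) (hcl : IsClosed C) :
    polar (polar C) ⊆ C := by
  obtain ⟨⟨hne, c, hc⟩, harc⟩ := hC
  have hc' : ∀ R ∈ C, dot c R < 0 := fun R hR => by
    by_contra! h
    have : R ∈ C ∩ hemisphere c := ⟨hR, h⟩
    rw [hc] at this; exact this
  -- The cone over `C`, to be separated from `x`; it is closed because projecting along the compact
  -- sphere is a closed map.
  let S : Set (EuclideanSpace ℝ (Fin (n + 1))) :=
    {v | ∃ x ∈ C, v = ‖v‖ • (x : EuclideanSpace ℝ (Fin (n + 1)))}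
  have hS : ∀ (a : ℝ) (x : Sph n), 0 ≤ a → x ∈ C →
      a • (x : EuclideanSpace ℝ (Fin (n + 1))) ∈ S := fun a x ha hx =>
    ⟨x, hx, by simp [norm_smul, abs_of_nonneg ha]⟩
  let K : ProperCone ℝ (EuclideanSpace ℝ (Fin (n + 1))) :=
    { carrier := S
      zero_mem' := by
        obtain ⟨x, hx⟩ := hne
        simpa using hS 0 x le_rfl hx
      add_mem' := by
        rintro v w ⟨x, hx, hv⟩ ⟨y, hy, hw⟩
        by_cases h0 : v + w = 0
        · rw [h0]; simpa using hS 0 x le_rfl hx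
        · obtain ⟨R, hR⟩ := exists_eq_smul h0
          refine ⟨R, harc x hx y hy (fun h => ?_) ⟨‖v + w‖⁻¹ * ‖v‖, ‖v + w‖⁻¹ * ‖w‖,
            by positivity, by positivity, ?_⟩, hR⟩
          · have h1 := hc' x hx
            have h2 := hc' y hy
            rw [h, dot_comm, dot_neg_left, dot_comm] at h1
            linarith
          · rw [mul_smul, mul_smul, ← smul_add, ← hv, ← hw, eq_inv_smul_iff₀, ← hR]
            exact norm_ne_zero_iff.2 h0
      smul_mem' := by
        rintro a v ⟨x, hx, hv⟩
        have := hS (a * ‖v‖) x (mul_nonneg a.2 (norm_nonneg _)) hx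
        rw [mul_smul, ← hv] at this
        exact this
      isClosed' := by
        have : S = Prod.fst '' {p : EuclideanSpace ℝ (Fin (n + 1)) × Sph n |
            p.2 ∈ C ∧ p.1 = ‖p.1‖ • (p.2 : EuclideanSpace ℝ (Fin (n + 1)))} := by
          ext v; simp [S]
        show IsClosed S
        rw [this]
        refine isClosedMap_fst_of_compactSpace _ ?_
        exact (hcl.preimage continuous_snd).inter (isClosed_eq (by fun_prop) (by fun_prop)) }
  intro x hx
  by_contra hxC
  have hxK : (x : EuclideanSpace ℝ (Fin (n + 1))) ∉ K := by
    rintro ⟨y, hy, h⟩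
    have : x = y := Subtype.ext (by simpa using h)
    exact hxC (this ▸ hy)
  obtain ⟨f, hf, hfx⟩ := ProperCone.hyperplane_separation' K hxK
  have hf0 : f ≠ 0 := by rintro rfl; simp at hfx
  obtain ⟨F, hF⟩ := exists_eq_smul hf0
  have hpos : 0 < ‖f‖ := norm_pos_iff.2 hf0
  have hFC : F ∈ polar C := fun R hR => by
    have h1 := hf R (show _ ∈ S by simpa using hS 1 R zero_le_one hR)
    rw [hF, real_inner_smul_right, real_inner_comm] at h1
    exact nonneg_of_mul_nonneg_right h1 hpos
  have h2 := hx F hFC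
  rw [hF, real_inner_smul_right] at hfx
  have : 0 ≤ ‖f‖ * dot x F := mul_nonneg hpos.le h2
  exact absurd this (not_le.2 hfx)

end Polar

/-! ### Constant width `π / 2` is self-polarity. -/

section ConstantWidth

variable {n : ℕ}

lemma Supports.mem_polar {C : Set (Sph n)} {Q : Sph n} (h : Supports Q C) : Q ∈ polar C := by
  obtain ⟨R, -, h, -, -⟩ := h
  exact fun S hS => h hS

/-- Moving a vector of the dual cone of `C` in a direction leaving it, one reaches a last vector of
the dual cone, which is orthogonal to some point of `C`. -/
lemma exists_last_mem_dual {C : Set (Sph n)} (hcl : IsClosed C)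
    (v w : EuclideanSpace ℝ (Fin (n + 1)))
    (hv : ∀ R ∈ C, 0 ≤ inner ℝ v (R : EuclideanSpace ℝ (Fin (n + 1))))
    (hw : ∃ R ∈ C, inner ℝ w (R : EuclideanSpace ℝ (Fin (n + 1))) < 0) :
    ∃ t : ℝ, 0 ≤ t ∧
      (∀ R ∈ C, 0 ≤ inner ℝ (v + t • w) (R : EuclideanSpace ℝ (Fin (n + 1)))) ∧
      ∃ R ∈ C, inner ℝ (v + t • w) (R : EuclideanSpace ℝ (Fin (n + 1))) = 0 := by
  obtain ⟨R₀, hR₀, hwR⟩ := hw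
  let T : Set ℝ := {t | 0 ≤ t ∧
    ∀ R ∈ C, 0 ≤ inner ℝ (v + t • w) (R : EuclideanSpace ℝ (Fin (n + 1)))}
  have hTcl : IsClosed T := by
    have : T = Ici 0 ∩ ⋂ R ∈ C,
        {t : ℝ | 0 ≤ inner ℝ (v + t • w) (R : EuclideanSpace ℝ (Fin (n + 1)))} := by
      ext t; simp [T]
    rw [this]
    exact isClosed_Ici.inter
      (isClosed_biInter fun R _ => isClosed_le continuous_const (by fun_prop))
  have hTb : BddAbove T := by
    refine ⟨inner ℝ v (R₀ : EuclideanSpace ℝ (Fin (n + 1))) /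
      -inner ℝ w (R₀ : EuclideanSpace ℝ (Fin (n + 1))), fun t ht => ?_⟩
    have := ht.2 R₀ hR₀
    rw [inner_add_left, real_inner_smul_left] at this
    rw [le_div_iff₀ (neg_pos.2 hwR)]
    linarith
  have hmem := hTcl.csSup_mem ⟨0, le_rfl, by simpa using hv⟩ hTb
  refine ⟨sSup T, hmem.1, hmem.2, ?_⟩
  by_contra! hne
  obtain ⟨r, hr, hrC⟩ := exists_pos_le_of_pos hcl
    (f := fun R => inner ℝ (v + sSup T • w) (R : EuclideanSpace ℝ (Fin (n + 1)))) (by fun_prop)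
    fun R hR => lt_of_le_of_ne (hmem.2 R hR) (hne R hR).symm
  have hw1 : 0 < ‖w‖ + 1 := by positivity
  have : sSup T + r / (‖w‖ + 1) ∈ T := by
    refine ⟨add_nonneg hmem.1 (by positivity), fun R hR => ?_⟩
    have h1 := hrC R hR
    have h2 : -‖w‖ ≤ inner ℝ w (R : EuclideanSpace ℝ (Fin (n + 1))) := by
      have := neg_le_of_abs_le (abs_real_inner_le_norm w (R : EuclideanSpace ℝ (Fin (n + 1))))
      simpa using this
    have h3 : r / (‖w‖ + 1) * (‖w‖ + 1) = r := div_mul_cancel₀ _ hw1.ne'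
    have h4 : 0 < r / (‖w‖ + 1) := by positivity
    rw [add_smul, ← add_assoc, inner_add_left, real_inner_smul_left]
    nlinarith
  have h5 := le_csSup hTb this
  have h4 : 0 < r / (‖w‖ + 1) := by positivity
  linarith

/-- A nonzero vector of the dual cone orthogonal to a point of `C` gives a supporting hemisphere. -/
lemma exists_supports_smul {C : Set (Sph n)} {v : EuclideanSpace ℝ (Fin (n + 1))} (h0 : v ≠ 0)
    (hv : ∀ R ∈ C, 0 ≤ inner ℝ v (R : EuclideanSpace ℝ (Fin (n + 1))))
    (hR : ∃ R ∈ C, inner ℝ v (R : EuclideanSpace ℝ (Fin (n + 1))) = 0) :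
    ∃ P : Sph n, Supports P C ∧ v = ‖v‖ • (P : EuclideanSpace ℝ (Fin (n + 1))) := by
  obtain ⟨P, hP⟩ := exists_eq_smul h0
  have hpos : 0 < ‖v‖ := norm_pos_iff.2 h0
  have key : ∀ R : Sph n, inner ℝ v (R : EuclideanSpace ℝ (Fin (n + 1))) = ‖v‖ * dot P R := by
    intro R
    conv_lhs => rw [hP]
    rw [real_inner_smul_left]; rfl
  obtain ⟨R, hRC, hR⟩ := hR
  refine ⟨P, supports_of_mem_polar (R := R) (fun S hS => ?_) hRC ?_, hP⟩
  · exact nonneg_of_mul_nonneg_right (key S ▸ hv S hS) hpos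
  · exact (mul_eq_zero.1 (key R ▸ hR)).resolve_left hpos.ne'

/-- Push `P` in the direction `-Q`: the product with `Q` only decreases, and an interior point of
`C` forces an exit from the dual cone. The last vector before it supports `C`. -/
lemma exists_supports_dot_neg {C : Set (Sph n)} (hC : IsSphericalConvexBody C) {P Q : Sph n}
    (hP : P ∈ polar C) (hQ : Q ∈ polar C) (h : dot P Q < 0) :
    ∃ P' : Sph n, Supports P' C ∧ dot P' Q < 0 := by
  obtain ⟨-, hcl, R₀, hR₀⟩ := hC
  obtain ⟨t, ht, h1, h2⟩ := exists_last_mem_dual hcl P (-Q) hP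
    ⟨R₀, interior_subset hR₀, by
      rw [inner_neg_left]; exact neg_neg_of_pos (dot_pos_of_mem_interior hQ hR₀)⟩
  have hneg : inner ℝ ((P : EuclideanSpace ℝ (Fin (n + 1))) + t • -(Q : EuclideanSpace ℝ _))
      (Q : EuclideanSpace ℝ (Fin (n + 1))) < 0 := by
    have h3 := dot_self Q
    simp only [dot] at h h3
    rw [inner_add_left, real_inner_smul_left, inner_neg_left, h3]
    linarith
  have h0 : (P : EuclideanSpace ℝ (Fin (n + 1))) + t • -(Q : EuclideanSpace ℝ _) ≠ 0 := fun h0 => by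
    rw [h0, inner_zero_left] at hneg; exact lt_irrefl _ hneg
  obtain ⟨P', hP', he⟩ := exists_supports_smul h0 h1 h2
  refine ⟨P', hP', ?_⟩
  rw [he, real_inner_smul_left] at hneg
  exact neg_of_mul_neg_right hneg (norm_nonneg _)

lemma luneThickness_ge_iff {P Q : Sph n} : Real.pi / 2 ≤ luneThickness P Q ↔ 0 ≤ dot P Q := by
  rw [← Real.arccos_le_pi_div_two, luneThickness]
  constructor <;> intro h <;> linarith

lemma luneThickness_eq_iff {P Q : Sph n} : Real.pi / 2 = luneThickness P Q ↔ dot P Q = 0 := by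
  rw [← Real.arccos_eq_pi_div_two, luneThickness]
  constructor <;> intro h <;> linarith

/-- A body of constant width `π / 2` contains the centers of the hemispheres containing it. -/
lemma IsBodyOfConstantWidth.polar_subset {C : Set (Sph n)}
    (hC : IsBodyOfConstantWidth C (Real.pi / 2)) : polar C ⊆ C := by
  obtain ⟨hbody, hw⟩ := hC
  have hsupp : ∀ P Q : Sph n, Supports P C → Supports Q C → 0 ≤ dot P Q := by
    intro P Q hP hQ
    by_cases h : P = Q
    · rw [h, dot_self]; exact zero_le_one
    · exact luneThickness_ge_iff.1 ((hw P hP).2 ⟨Q, hQ, h, rfl⟩)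
  refine fun P hP => polar_polar_subset hbody.1 hbody.2.1 fun Q hQ => ?_
  by_contra! hneg
  -- Replace the two centers by supporting ones, one at a time.
  obtain ⟨P', hP', h1⟩ := exists_supports_dot_neg hbody hP hQ hneg
  obtain ⟨Q', hQ', h2⟩ := exists_supports_dot_neg hbody hQ hP'.mem_polar (by rwa [dot_comm])
  exact absurd (hsupp Q' P' hQ' hP') (not_le.2 h2)

lemma IsHemispherical.exists_dot_pos {C : Set (Sph n)} (hC : IsHemispherical C) :
    ∃ c : Sph n, ∀ R ∈ C, 0 < dot c R := by
  obtain ⟨-, c, hc⟩ := hC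
  refine ⟨-c, fun R hR => ?_⟩
  rw [dot_neg_left, neg_pos]
  by_contra! h
  have : R ∈ C ∩ hemisphere c := ⟨hR, h⟩
  rw [hc] at this; exact this

/-- Starting at a center `c` of an open hemisphere containing `C` and moving towards or orthogonally
to a point of `C`, one reaches the center of a supporting hemisphere. -/
lemma exists_supports_add_smul {C : Set (Sph n)} (hcl : IsClosed C) {c x : Sph n}
    (hc : ∀ R ∈ C, 0 < dot c R) (hcx : 0 ≤ dot c x) (hx : x ∉ polar C) :
    ∃ P : Sph n, Supports P C ∧ ∃ r : ℝ, 0 < r ∧ ∃ t : ℝ, 0 ≤ t ∧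
      (c : EuclideanSpace ℝ (Fin (n + 1))) + t • (x : EuclideanSpace ℝ (Fin (n + 1))) =
        r • (P : EuclideanSpace ℝ (Fin (n + 1))) := by
  obtain ⟨t, ht, h1, h2⟩ := exists_last_mem_dual hcl c x (fun R hR => (hc R hR).le)
    (by simpa [polar, dot] using hx)
  have h0 : (c : EuclideanSpace ℝ (Fin (n + 1))) + t • (x : EuclideanSpace ℝ _) ≠ 0 := fun h0 => by
    have h3 : inner ℝ (c : EuclideanSpace ℝ (Fin (n + 1)))
      ((c : EuclideanSpace ℝ (Fin (n + 1))) + t • (x : EuclideanSpace ℝ _)) = (0 : ℝ) := by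
      rw [h0, inner_zero_right]
    have h4 := dot_self c
    simp only [dot] at h4 hcx
    rw [inner_add_right, real_inner_smul_right, h4] at h3
    have := mul_nonneg ht hcx
    linarith
  obtain ⟨P, hP, he⟩ := exists_supports_smul h0 h1 h2
  exact ⟨P, hP, _, norm_pos_iff.2 h0, t, ht, he⟩

/-- A body of constant width `π / 2` is self-polar. -/
lemma IsBodyOfConstantWidth.polar_eq {C : Set (Sph n)}
    (hC : IsBodyOfConstantWidth C (Real.pi / 2)) : polar C = C := by
  have hsub := hC.polar_subset
  refine hsub.antisymm fun x hx => ?_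
  by_contra hxp
  obtain ⟨⟨hconv, hcl, -⟩, hw⟩ := hC
  obtain ⟨c, hc⟩ := hconv.1.exists_dot_pos
  obtain ⟨P, hP, r, hr, t, ht, he⟩ := exists_supports_add_smul hcl hc (hc x hx).le hxp
  -- The width at `P` is attained at some `Q` orthogonal to `P`. But `Q ∈ C`, so `c + t • x`, a
  -- positive multiple of `P`, has positive product with `Q`.
  obtain ⟨Q, hQ, -, hPQ⟩ := (hw P hP).1
  rw [luneThickness_eq_iff] at hPQ
  have h1 := hc Q (hsub hQ.mem_polar)
  have h2 := hQ.mem_polar x hx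
  rw [dot_comm] at h2
  have h3 : dot c Q + t * dot x Q = r * dot P Q := by
    simp only [dot]
    rw [← real_inner_smul_left, ← real_inner_smul_left, ← inner_add_left, he]
  rw [hPQ] at h3
  have := mul_nonneg ht h2
  linarith

/-- A self-polar set contained in an open hemisphere is a body of constant width `π / 2`. -/
lemma isBodyOfConstantWidth_of_polar_eq {K : Set (Sph n)} (hK : polar K = K) (hne : K.Nonempty)
    {c : Sph n} (hc : ∀ R ∈ K, 0 < dot c R) : IsBodyOfConstantWidth K (Real.pi / 2) := by
  have hcl : IsClosed K := hK ▸ isClosed_polar K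
  refine ⟨⟨⟨⟨hne, -c, ?_⟩, ?_⟩, hcl, c, ?_⟩, ?_⟩
  · refine eq_empty_of_forall_notMem fun R hR => ?_
    have h1 : 0 ≤ dot (-c) R := hR.2
    have h2 := hc R hR.1
    rw [dot_neg_left] at h1
    linarith
  · rintro P hP Q hQ - R ⟨a, b, ha, hb, hR⟩
    rw [← hK] at hP hQ ⊢
    intro S hS
    have h1 := mul_nonneg ha (hP S hS)
    have h2 := mul_nonneg hb (hQ S hS)
    simp only [dot] at h1 h2 ⊢
    rw [hR, inner_add_left, real_inner_smul_left, real_inner_smul_left]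
    linarith
  · obtain ⟨r, hr, hrK⟩ := exists_pos_le_of_pos hcl (continuous_dot c) hc
    refine mem_interior.2 ⟨Metric.ball c r, fun x hx => ?_, Metric.isOpen_ball,
      Metric.mem_ball_self hr⟩
    rw [← hK]
    intro y hy
    have h1 := hrK y hy
    have h2 : ‖(x : EuclideanSpace ℝ (Fin (n + 1))) - c‖ < r := by
      rwa [Metric.mem_ball, Subtype.dist_eq, dist_eq_norm] at hx
    have h3 := neg_le_of_abs_le (abs_real_inner_le_norm
      ((x : EuclideanSpace ℝ (Fin (n + 1))) - c) (y : EuclideanSpace ℝ (Fin (n + 1))))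
    rw [inner_sub_left] at h3
    have h4 : ‖(y : EuclideanSpace ℝ (Fin (n + 1)))‖ = 1 := by simp
    rw [h4, mul_one] at h3
    simp only [dot] at h1 ⊢
    linarith
  · rintro P hP
    have hPK : P ∈ K := hK ▸ hP.mem_polar
    obtain ⟨R, -, -, hR, h0⟩ := hP
    -- The contact point `R` is itself the center of a supporting hemisphere, touching `K` at `P`.
    refine ⟨⟨R, ?_, ?_, luneThickness_eq_iff.2 h0⟩, ?_⟩
    · exact supports_of_mem_polar (by rwa [hK]) hPK (by rwa [dot_comm])
    · rintro rfl
      rw [dot_self] at h0; exact one_ne_zero h0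
    · rintro _ ⟨Q, hQ, -, rfl⟩
      rw [luneThickness_ge_iff, dot_comm]
      exact hQ.mem_polar P hPK

end ConstantWidth

/-! ### Completing a finite set to a self-polar polytope. -/

section SelfPolarPolytopes

lemma polar_eq_iInter {n : ℕ} (F : Set (Sph n)) : polar F = ⋂ P ∈ F, hemisphere P := by
  ext Q; simp [polar, hemisphere, dot_comm]

/-- The **Minkowski-Weyl theorem** on the sphere: the polar of a finite set is the bipolar of a
finite set. -/
lemma exists_finite_polar_subset {n : ℕ} {G : Set (Sph n)} (hG : G.Finite) :
    ∃ H : Set (Sph n), H.Finite ∧ H ⊆ polar G ∧ polar H ⊆ polar (polar G) := by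
  classical
  obtain ⟨H, h1, h2⟩ := exists_finset_dual_generators
    (hG.toFinset.image ((↑) : Sph n → EuclideanSpace ℝ (Fin (n + 1))))
  refine ⟨(↑) ⁻¹' ((fun h => ‖h‖⁻¹ • h) '' (H : Set (EuclideanSpace ℝ (Fin (n + 1))))),
    (H.finite_toSet.image _).preimage Subtype.val_injective.injOn, ?_, ?_⟩
  · rintro P ⟨h, hH, hP⟩ g hg
    have := h1 h hH g (Finset.mem_image_of_mem _ (hG.mem_toFinset.2 hg))
    rw [dot, ← hP, real_inner_smul_left]
    positivity
  · intro x hx y hy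
    rw [dot_comm]
    refine h2 x (fun h hh => ?_) y fun g hg => ?_
    · by_cases h0 : h = 0
      · simp [h0]
      · obtain ⟨P, hP⟩ := exists_eq_smul h0
        have h3 : 0 ≤ dot x P := by
          refine hx P ⟨h, hh, ?_⟩
          show ‖h‖⁻¹ • h = _
          rw [inv_smul_eq_iff₀ (norm_ne_zero_iff.2 h0)]
          exact hP
        rw [dot_comm] at h3
        rw [hP, real_inner_smul_left]
        exact mul_nonneg (norm_nonneg _) h3
    · obtain ⟨g, hg', rfl⟩ := Finset.mem_image.1 hg
      exact hy g (hG.mem_toFinset.1 hg')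

/-- Two orthogonal points of `𝕊²` and a point orthogonal to both form an orthonormal frame. -/
lemma exists_frame {p q : Sph 2} (h : dot p q = 0) :
    ∃ N : EuclideanSpace ℝ (Fin 3), ∀ x y : Sph 2, dot x y =
      dot p x * dot p y + dot q x * dot q y + inner ℝ N (x : EuclideanSpace ℝ (Fin 3)) *
        inner ℝ N (y : EuclideanSpace ℝ (Fin 3)) := by
  have hv : Orthonormal ℝ (({0, 1} : Set (Fin 3)).domRestrict
      ![(p : EuclideanSpace ℝ (Fin 3)), q, 0]) := by
    have h' : inner ℝ (q : EuclideanSpace ℝ (Fin 3)) (p : EuclideanSpace ℝ (Fin 3)) = (0 : ℝ) := by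
      rw [real_inner_comm]; exact h
    constructor
    · rintro ⟨i, rfl | rfl⟩ <;> simp
    · rintro ⟨i, rfl | rfl⟩ ⟨j, rfl | rfl⟩ hij <;> simp at hij ⊢ <;> assumption
  obtain ⟨b, hb⟩ := hv.exists_orthonormalBasis_extension_of_card_eq (by simp)
  have h0 : b 0 = p := hb 0 (by simp)
  have h1 : b 1 = q := hb 1 (by simp)
  refine ⟨b 2, fun x y => ?_⟩
  have := b.sum_inner_mul_inner x y
  rw [Fin.sum_univ_three, h0, h1] at this
  rw [dot, ← this, real_inner_comm, real_inner_comm (q : EuclideanSpace ℝ (Fin 3)),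
    real_inner_comm (b 2)]
  rfl

/-- There is a point of `𝕊²` orthogonal to a given one. -/
lemma exists_dot_eq_zero (c : Sph 2) : ∃ x : Sph 2, dot c x = 0 := by
  have hv : Orthonormal ℝ (({0} : Set (Fin 3)).domRestrict
      ![(c : EuclideanSpace ℝ (Fin 3)), 0, 0]) := by
    constructor
    · rintro ⟨i, rfl⟩; simp
    · rintro ⟨i, rfl⟩ ⟨j, rfl⟩ hij
      exact absurd rfl hij
  obtain ⟨b, hb⟩ := hv.exists_orthonormalBasis_extension_of_card_eq (by simp)
  have h0 : b 0 = c := hb 0 (by simp)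
  refine ⟨⟨b 1, by simp⟩, ?_⟩
  have : inner ℝ (b 0) (b 1) = (0 : ℝ) := b.orthonormal.2 (by decide)
  rwa [h0] at this

/-- A self-polar set contained in an open hemisphere contains two orthogonal points. -/
lemma exists_orthogonal_pair {C : Set (Sph 2)} (hC : polar C = C) {c : Sph 2}
    (hc : ∀ R ∈ C, 0 < dot c R) : ∃ p ∈ C, ∃ q ∈ C, dot p q = 0 := by
  have hcl : IsClosed C := hC ▸ isClosed_polar C
  obtain ⟨x, hcx, hx⟩ : ∃ x : Sph 2, 0 ≤ dot c x ∧ x ∉ polar C := by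
    obtain ⟨x, hx⟩ := exists_dot_eq_zero c
    by_cases h : x ∈ polar C
    · refine ⟨-x, ?_, fun h' => ?_⟩
      · rw [dot_comm, dot_neg_left, dot_comm, hx, neg_zero]
      · have := h' x (hC ▸ h)
        rw [dot_neg_left, dot_self] at this
        linarith
    · exact ⟨x, hx.ge, h⟩
  obtain ⟨P, hP, -⟩ := exists_supports_add_smul hcl hc hcx hx
  have hPC : P ∈ C := hC ▸ hP.mem_polar
  obtain ⟨R, -, -, hR, h0⟩ := hP
  exact ⟨P, hPC, R, hR, h0⟩

/-- A finite set of points of `𝕊²` with pairwise nonnegative products, two of which are orthogonal,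
extends to a self-polar intersection of finitely many hemispheres. -/
lemma exists_self_polar_polytope {G : Set (Sph 2)} (hG : G.Finite) (hGG : G ⊆ polar G)
    {p q : Sph 2} (hp : p ∈ G) (hq : q ∈ G) (hpq : dot p q = 0) :
    ∃ F : Set (Sph 2), F.Finite ∧ G ⊆ F ∧ F ⊆ polar F ∧ polar (polar F) = polar F := by
  obtain ⟨H, hHf, hHG, hH⟩ := exists_finite_polar_subset hG
  obtain ⟨N, hN⟩ := exists_frame hpq
  have same : ∀ x ∈ polar G, ∀ y ∈ polar G,
      0 ≤ inner ℝ N (x : EuclideanSpace ℝ (Fin 3)) *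
        inner ℝ N (y : EuclideanSpace ℝ (Fin 3)) → 0 ≤ dot x y := by
    intro x hx y hy h
    have h1 := mul_nonneg (hx p hp) (hy p hp)
    have h2 := mul_nonneg (hx q hq) (hy q hq)
    rw [dot_comm x, dot_comm y] at h1 h2
    rw [hN]
    linarith
  set F := G ∪ {h ∈ H | inner ℝ N (h : EuclideanSpace ℝ (Fin 3)) ≤ (0 : ℝ)} with hF
  have hFG : polar F ⊆ polar G := fun x hx R hR => hx R (Or.inl hR)
  have hFF : F ⊆ polar F := by
    rintro x (hx | ⟨hx, hxN⟩) y (hy | ⟨hy, hyN⟩)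
    · exact hGG hx y hy
    · rw [dot_comm]; exact hHG hy x hx
    · exact hHG hx y hy
    · exact same x (hHG hx) y (hHG hy) (mul_nonneg_of_nonpos_of_nonpos hxN hyN)
  -- Generators with `N`-coordinate at most `0` lie in `F`, and the others are on the side of `x`;
  -- so `x` is nonnegative on all of `polar G`.
  have opp : ∀ x ∈ polar F, ∀ y ∈ polar F, 0 ≤ inner ℝ N (x : EuclideanSpace ℝ (Fin 3)) →
      0 ≤ dot x y := by
    intro x hx y hy hxN
    refine hH (fun h hh => ?_) y (hFG hy)
    rcases le_total (inner ℝ N (h : EuclideanSpace ℝ (Fin 3))) (0 : ℝ) with hs | hs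
    · exact hx h (Or.inr ⟨hh, hs⟩)
    · exact same x (hFG hx) h (hHG hh) (mul_nonneg hxN hs)
  refine ⟨F, hG.union (hHf.subset (sep_subset _ _)), subset_union_left, hFF, Subset.antisymm ?_ ?_⟩
  · exact fun x hx y hy => hx y (hFF hy)
  · intro x hx y hy
    rcases le_total 0 (inner ℝ N (x : EuclideanSpace ℝ (Fin 3))) with hxN | hxN
    · exact opp x hx y hy hxN
    · rcases le_total 0 (inner ℝ N (y : EuclideanSpace ℝ (Fin 3))) with hyN | hyN
      · rw [dot_comm]; exact opp y hy x hx hyN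
      · exact same x (hFG hx) y (hFG hy) (mul_nonneg_of_nonpos_of_nonpos hxN hyN)

end SelfPolarPolytopes

/-! ### Metric estimates. -/

section Approximation

variable {n : ℕ}

lemma exists_geodist_le {ε : ℝ} (hε : 0 < ε) :
    ∃ η > 0, ∀ P Q : Sph n, 1 - η ≤ dot P Q → geodist P Q ≤ ε := by
  have h0 : 0 < min ε Real.pi := lt_min hε Real.pi_pos
  refine ⟨1 - Real.cos (min ε Real.pi), ?_, fun P Q h => ?_⟩
  · have := Real.cos_lt_cos_of_nonneg_of_le_pi le_rfl (min_le_right ε _) h0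
    rw [Real.cos_zero] at this
    linarith
  · calc geodist P Q ≤ Real.arccos (Real.cos (min ε Real.pi)) :=
          Real.arccos_le_arccos (by linarith)
      _ = min ε Real.pi := Real.arccos_cos h0.le (min_le_right _ _)
      _ ≤ ε := min_le_left _ _

lemma one_sub_le_dot {P Q : Sph n} {δ : ℝ} (h : dist P Q ≤ δ) (hδ : δ ≤ 1) : 1 - δ ≤ dot P Q := by
  have h1 := norm_sub_sq_real (P : EuclideanSpace ℝ (Fin (n + 1))) Q
  rw [Subtype.dist_eq, dist_eq_norm] at h
  have hP : ‖(P : EuclideanSpace ℝ (Fin (n + 1)))‖ = 1 := by simp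
  have hQ : ‖(Q : EuclideanSpace ℝ (Fin (n + 1)))‖ = 1 := by simp
  rw [hP, hQ] at h1
  simp only [dot]
  have := norm_nonneg ((P : EuclideanSpace ℝ (Fin (n + 1))) - Q)
  nlinarith

lemma sub_dist_le_dot (P Q R : Sph n) : dot P Q - dist Q R ≤ dot P R := by
  have h := le_of_abs_le (abs_real_inner_le_norm (P : EuclideanSpace ℝ (Fin (n + 1)))
    ((Q : EuclideanSpace ℝ (Fin (n + 1))) - R))
  have hP : ‖(P : EuclideanSpace ℝ (Fin (n + 1)))‖ = 1 := by simp
  rw [inner_sub_right, hP, one_mul, ← dist_eq_norm, ← Subtype.dist_eq] at h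
  simp only [dot]
  linarith

/-- A point almost in the polar of a set `C` contained in an open hemisphere is close to
the polar of `C`. -/
lemma exists_near_mem_polar {C : Set (Sph n)} {c : Sph n} {r t : ℝ}
    (hc : ∀ R ∈ C, r ≤ dot c R) (ht0 : 0 ≤ t) (ht : t ≤ 1 / 4) {x : Sph n}
    (hx : ∀ R ∈ C, -(t * r) ≤ dot x R) :
    ∃ z ∈ polar C, 1 - 2 * t ≤ dot x z ∧
      ∃ s : ℝ, 1 - t ≤ s ∧ dot c x + t = s * dot c z := by
  -- Adding `t • c` raises every product with `C` by at least `t * r`, cancelling the defect.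
  set v := (x : EuclideanSpace ℝ (Fin (n + 1))) + t • (c : EuclideanSpace ℝ (Fin (n + 1))) with hv
  have hxn : ‖(x : EuclideanSpace ℝ (Fin (n + 1)))‖ = 1 := by simp
  have hcn : ‖t • (c : EuclideanSpace ℝ (Fin (n + 1)))‖ = t := by
    simp [norm_smul, abs_of_nonneg ht0]
  have hlow : 1 - t ≤ ‖v‖ := by
    have := norm_sub_le_norm_add (x : EuclideanSpace ℝ (Fin (n + 1)))
      (t • (c : EuclideanSpace ℝ (Fin (n + 1))))
    rwa [hxn, hcn] at this
  have hup : ‖v‖ ≤ 1 + t := by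
    have := norm_add_le (x : EuclideanSpace ℝ (Fin (n + 1)))
      (t • (c : EuclideanSpace ℝ (Fin (n + 1))))
    rwa [hxn, hcn] at this
  have hpos : 0 < ‖v‖ := by linarith
  obtain ⟨z, hz⟩ := exists_eq_smul (norm_pos_iff.1 hpos)
  have key : ∀ R : Sph n, dot x R + t * dot c R = ‖v‖ * dot z R := fun R => by
    simp only [dot]
    rw [← real_inner_smul_left, ← real_inner_smul_left, ← inner_add_left, ← hz]
  refine ⟨z, fun R hR => ?_, ?_, ‖v‖, hlow, ?_⟩
  · refine nonneg_of_mul_nonneg_right (a := ‖v‖) ?_ hpos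
    rw [← key]
    have := mul_le_mul_of_nonneg_left (hc R hR) ht0
    linarith [hx R hR]
  · have h1 := key x
    rw [dot_self] at h1
    have h2 : -1 ≤ dot c x := by
      have := dot_le_one (-c) x
      rw [dot_neg_left] at this; linarith
    rw [dot_comm]
    -- `dot z x = (1 + t * dot c x) / ‖v‖ ≥ (1 - t) / (1 + t) ≥ 1 - 2 * t`.
    by_contra! hlt
    nlinarith
  · have h1 := key c
    rw [dot_self] at h1
    rw [dot_comm c x, dot_comm c z, ← h1, mul_one]

end Approximation

end SphericalConvex

theorem theorem1p3 (C : Set (SphericalConvex.Sph 2))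
    (hC : SphericalConvex.IsBodyOfConstantWidth C (Real.pi / 2)) (ε : ℝ) (hε : 0 < ε) :
    ∃ P : Set (SphericalConvex.Sph 2),
      SphericalConvex.IsSphericalPolytope P ∧
      SphericalConvex.IsBodyOfConstantWidth P (Real.pi / 2) ∧
      SphericalConvex.hausdorffDistance C P ≤ ε := by
  open SphericalConvex in
  have hCC := hC.polar_eq
  have hcl : IsClosed C := hC.1.2.1
  obtain ⟨c, hc⟩ := hC.1.1.1.exists_dot_pos
  obtain ⟨p, hp, q, hq, hpq⟩ := exists_orthogonal_pair hCC hc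
  obtain ⟨r, hr, hrC⟩ := exists_pos_le_of_pos hcl (continuous_dot c) hc
  have hr1 : r ≤ 1 := (hrC p hp).trans (dot_le_one c p)
  obtain ⟨η, hη, hgeo⟩ := exists_geodist_le (n := 2) hε
  -- `t ≤ η / 2` controls the distance; `t ≤ r / 4` keeps `polar F` in the open hemisphere at `c`,
  -- since `(1 - t) * r - t > 0`.
  obtain ⟨t, ht, htη, htr⟩ : ∃ t : ℝ, 0 < t ∧ t ≤ η / 2 ∧ t ≤ r / 4 :=
    ⟨min (η / 2) (r / 4), by positivity, min_le_left _ _, min_le_right _ _⟩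
  have htr1 : t * r ≤ t := by nlinarith
  obtain ⟨T, hTC, hTf, hT⟩ := hcl.isCompact.finite_cover_balls (mul_pos ht hr)
  set G : Set (Sph 2) := insert p (insert q T) with hG
  have hGC : G ⊆ C := insert_subset hp (insert_subset hq hTC)
  have hnet : ∀ y ∈ C, ∃ g ∈ G, dist y g ≤ t * r := fun y hy => by
    obtain ⟨g, hg, hyg⟩ := mem_iUnion₂.1 (hT hy)
    exact ⟨g, by simp [hG, hg], (Metric.mem_ball.1 hyg).le⟩
  obtain ⟨F, hFf, hGF, hFF, hself⟩ := exists_self_polar_polytope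
    ((hTf.insert q).insert p) (fun x hx y hy => (hCC.symm ▸ hGC hx : x ∈ polar C) y (hGC hy))
    (mem_insert p _) (mem_insert_of_mem p (mem_insert q T)) hpq
  have hnear : ∀ x ∈ polar F, ∃ z ∈ C, 1 - 2 * t ≤ dot x z ∧
      ∃ s : ℝ, 1 - t ≤ s ∧ dot c x + t = s * dot c z := by
    intro x hx
    rw [← hCC]
    refine exists_near_mem_polar hrC ht.le (by linarith) fun R hR => ?_
    obtain ⟨g, hg, hRg⟩ := hnet R hR
    have h1 := hx g (hGF hg)
    have h2 := sub_dist_le_dot x g R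
    rw [dist_comm] at hRg
    linarith
  have hpos : ∀ x ∈ polar F, 0 < dot c x := by
    intro x hx
    obtain ⟨z, hz, -, s, hs, h⟩ := hnear x hx
    have h1 := mul_le_mul hs (hrC z hz) hr.le (by linarith)
    nlinarith
  have hne : (polar F).Nonempty := ⟨p, hFF (hGF (mem_insert p _))⟩
  have hbody := isBodyOfConstantWidth_of_polar_eq hself hne hpos
  refine ⟨polar F, ⟨hbody.1, F, hFf, polar_eq_iInter F⟩, hbody,
    csInf_le ⟨0, fun s hs => hs.1⟩ ⟨hε.le, fun y hy => ?_, fun x hx => ?_⟩⟩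
  · obtain ⟨g, hg, hyg⟩ := hnet y hy
    refine ⟨g, hFF (hGF hg), hgeo _ _ ?_⟩
    have := one_sub_le_dot (hyg.trans htr1) (by linarith)
    linarith
  · obtain ⟨z, hz, h, -⟩ := hnear x hx
    rw [dot_comm] at h
    exact ⟨z, hz, hgeo _ _ (by linarith)⟩
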